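/- **Theorem.** There is an algorithm that computes generators of a monomial ideal in an affine semigroup ring from its standard pairs. Precisely, let $A\subset\mathbb{Z}^d\smallsetminus\{0\}$ be a finite set whose cone $\mathbb{R}_{\ge 0}A$ is strongly convex (contains no lines), let $\mathbb{N}A$ be the monoid of nonnegative integer combinations of $A$, let $\Bbbk$ be a field, and let $\Bbbk[\mathbb{N}A]$ be the semigroup ring, with monomials $t^a$, $a\in\mathbb{N}A$, graded by $\mathbb{Z}^d$ via $\deg t^a=a$. A monomial ideal is a $\mathbb{Z}^d$-homogeneous ideal. A subset $F\subseteq A$ is a face of $A$ if $\mathbb{R}_{\ge0}F$ is a face of $\mathbb{R}_{\ge0}A$ and $\mathbb{R}_{\ge0}F\cap A=F$. A proper pair of a monomial ideal $I$ is a pair $(a,F)$ with $a\in\mathbb{N}A$ and $F$ a face of $A$ such that $t^{b}\notin I$ for all $b\in a+\mathbb{N}F$. A standard pair of $I$ is a proper pair that is maximal for the partial order $(a,F)\prec(b,G)\iff a+\mathbb{N}F\subseteq b+\mathbb{N}G$. There is a single algorithm (a partial recursive function), independent of $d$, $A$, $\Bbbk$ and $I$, with the following property. For every such $d$, $A$,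 $\Bbbk$ and every monomial ideal $I\subseteq\Bbbk[\mathbb{N}A]$, given as input $d$, a finite list of the elements of $A$, and a finite list of the standard pairs $(a,F)$ of $I$ (each face $F$ given by a finite list of its elements), the algorithm terminates and outputs a finite list $g_1,\dots,g_r$ of elements of $\mathbb{N}A$ such that $I=\langle t^{g_1},\dots,t^{g_r}\rangle$. -/

import Mathlib

namespace StdPairs

/-- The affine semigroup `ℕA`: all nonnegative integer combinations of the elements of `A`. -/
abbrev semigroup {d : ℕ} (A : Finset (Fin d → ℤ)) : AddSubmonoid (Fin d → ℤ) :=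
  AddSubmonoid.closure (A : Set (Fin d → ℤ))

/-- The cone `ℝ≥0 A` in `ℝ^d`: all nonnegative real combinations of the elements of `A`. -/
noncomputable def cone {d : ℕ} (A : Finset (Fin d → ℤ)) : PointedCone ℝ (Fin d → ℝ) :=
  PointedCone.hull ℝ ((fun (v : Fin d → ℤ) (i : Fin d) => (v i : ℝ)) '' (A : Set (Fin d → ℤ)))

/-- A configuration: a finite set of nonzero lattice points whose cone is strongly convex, that is,
contains no lines. -/
structure IsConfiguration {d : ℕ} (A : Finset (Fin d → ℤ)) : Prop where
  zero_notMem : (0 : Fin d → ℤ) ∉ A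
  stronglyConvex : ∀ x ∈ cone A, -x ∈ cone A → x = 0

/-- `F` is a face of the configuration `A`: `F ⊆ A`, the cone `ℝ≥0 F` is a face of `ℝ≥0 A`, and
`ℝ≥0 F ∩ A = F`. -/
structure IsFace {d : ℕ} (A F : Finset (Fin d → ℤ)) : Prop where
  subset : F ⊆ A
  cone_isFaceOf : (cone F).IsFaceOf (cone A)
  mem_of_mem_cone : ∀ v ∈ A, (fun i => (v i : ℝ)) ∈ cone F → v ∈ F

/-- The affine semigroup ring `k[ℕA]`. -/
abbrev SemigroupRing (k : Type*) [Field k] {d : ℕ} (A : Finset (Fin d → ℤ)) : Type _ :=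
  AddMonoidAlgebra k (semigroup A)

/-- The monomial `t^a` of `k[ℕA]`, for `a ∈ ℕA`. -/
noncomputable def monomial (k : Type*) [Field k] {d : ℕ} (A : Finset (Fin d → ℤ))
    (a : semigroup A) : SemigroupRing k A :=
  AddMonoidAlgebra.single a 1

/-- A monomial ideal of `k[ℕA]` is an ideal that is homogeneous for the `ℤ^d`-grading
`deg t^a = a`. -/
def IsMonomialIdeal {k : Type*} [Field k] {d : ℕ} {A : Finset (Fin d → ℤ)}
    (I : Ideal (SemigroupRing k A)) : Prop :=
  I.IsHomogeneous (AddMonoidAlgebra.gradeBy k (semigroup A).subtype)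

/-- The exponents of the standard monomials of `I`, the monomials of `k[ℕA]` not in `I`. -/
def stdMono {k : Type*} [Field k] {d : ℕ} {A : Finset (Fin d → ℤ)}
    (I : Ideal (SemigroupRing k A)) : Set (Fin d → ℤ) :=
  {a | ∃ h : a ∈ semigroup A, monomial k A ⟨a, h⟩ ∉ I}

/-- `(a, F)` is a pair of `A`: `a ∈ ℕA` and `F` is a face of `A`. -/
def IsPair {d : ℕ} (A : Finset (Fin d → ℤ)) (p : (Fin d → ℤ) × Finset (Fin d → ℤ)) : Prop :=
  p.1 ∈ semigroup A ∧ IsFace A p.2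

/-- The set `a + ℕF` of a pair `(a, F)`. -/
def pairSet {d : ℕ} (p : (Fin d → ℤ) × Finset (Fin d → ℤ)) : Set (Fin d → ℤ) :=
  {x | ∃ c ∈ semigroup p.2, x = p.1 + c}

/-- `(a, F)` is a proper pair of `I`: a pair of `A` with `a + ℕF ⊆ stdMono I`. -/
def IsProperPair {k : Type*} [Field k] {d : ℕ} {A : Finset (Fin d → ℤ)}
    (I : Ideal (SemigroupRing k A)) (p : (Fin d → ℤ) × Finset (Fin d → ℤ)) : Prop :=
  IsPair A p ∧ pairSet p ⊆ stdMono I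

/-- The set of standard pairs of `I`: the proper pairs `(a, F)` that are maximal for the partial
order `(a, F) ≺ (b, G) ↔ a + ℕF ⊆ b + ℕG`. -/
def stdPairs {k : Type*} [Field k] {d : ℕ} {A : Finset (Fin d → ℤ)}
    (I : Ideal (SemigroupRing k A)) : Set ((Fin d → ℤ) × Finset (Fin d → ℤ)) :=
  {p | IsProperPair I p ∧ ∀ q, IsProperPair I q → pairSet p ⊆ pairSet q → q = p}

/-- A list of lattice points as a list of lists of integers. -/
def codePoints {d : ℕ} (L : List (Fin d → ℤ)) : List (List ℤ) :=
  L.map List.ofFn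

/-- A list of pairs `(a, F)`, with `F` given by a list of its elements, as a list of pairs of a list
of integers and a list of lists of integers. -/
def codePairs {d : ℕ} (P : List ((Fin d → ℤ) × List (Fin d → ℤ))) :
    List (List ℤ × List (List ℤ)) :=
  P.map fun p => (List.ofFn p.1, codePoints p.2)

end StdPairs

/-! List `A` as `a_1, …, a_n` and pull the ideal back along `ℕ^n → ℕA`. The exponents landing in `I`
form an upper set, so by Dickson's lemma (`exists_min_mem`) there is an `M` such that truncating
coordinates at `M` keeps a point in it. Hence the box `[0, M]^n` yields generators of `I`; the
difficulty is to recognise a suitable `M` from the standard pairs alone. The certificate is this: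
every standard point `x` of the box lies in a given pair `(a, F)` with `a_i ∈ F` whenever `x_i = M`.
It suffices (`span_output_eq`): if the truncation of `y` were standard, the directions cut off would
all lie in `F`, so `y` would stay in `a + ℕF` and be standard too. It exists (`exists_certifies`):
for Dickson's `M`, raising coordinates equal to `M` leaves the truncation unchanged, so `x + ℕS` is
standard, where `S` is the set of `a_i` with `x_i = M`. Every element of the smallest face `F ⊇ S`
divides an element of `ℕS` (`exists_face`), so `(x, F)` is a proper pair, and it lies below a
standard pair. Membership in `a + ℕF` is decidable because an integral functional `h`, positive on
`A`, bounds the coefficients. The algorithm searches for `(M, h)` by brute force. -/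

namespace StdPairs

/-! ### Computability of the certificate search. -/

section Computability

/-- Sign and absolute value can be read off the parity and the half of the code, which reduces
integer arithmetic to arithmetic on codes. -/
theorem encode_int (z : ℤ) :
    Encodable.encode z = if 0 ≤ z then 2 * z.toNat else 2 * (-z).toNat - 1 := by
  change Equiv.intEquivNat z = _
  cases z with
  | ofNat n =>
    change Nat.bit false n = _
    simp
  | negSucc n =>
    rw [if_neg (by omega)]
    simp [Equiv.intEquivNat, Equiv.intEquivNatSumNat, Equiv.natSumNatEquivNat]
    omega

theorem primrec_toNat : Primrec Int.toNat := by
  have h : Primrec fun z : ℤ => if Encodable.encode z % 2 = 0 then Encodable.encode z / 2 else 0 :=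
    Primrec.ite (Primrec.eq.comp (Primrec.nat_mod.comp Primrec.encode (Primrec.const 2))
      (Primrec.const 0)) (Primrec.nat_div.comp Primrec.encode (Primrec.const 2)) (Primrec.const 0)
  refine h.of_eq fun z => ?_
  rw [encode_int]
  split_ifs <;> omega

theorem primrec_toNat_neg : Primrec fun z : ℤ => (-z).toNat := by
  have h : Primrec fun z : ℤ =>
      if Encodable.encode z % 2 = 0 then 0 else (Encodable.encode z + 1) / 2 :=
    Primrec.ite (Primrec.eq.comp (Primrec.nat_mod.comp Primrec.encode (Primrec.const 2))
      (Primrec.const 0)) (Primrec.const 0)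
      (Primrec.nat_div.comp (Primrec.succ.comp Primrec.encode) (Primrec.const 2))
  refine h.of_eq fun z => ?_
  rw [encode_int]
  split_ifs <;> omega

/-- Integers are differences of their positive and negative parts, so sums and products of integers
reduce to natural arithmetic followed by this map. -/
theorem primrec_natCast_sub : Primrec₂ fun a b : ℕ => (a : ℤ) - b := by
  refine Primrec₂.encode_iff.1 ?_
  have h : Primrec₂ fun a b : ℕ => if b ≤ a then 2 * (a - b) else 2 * (b - a) - 1 :=
    Primrec.ite (Primrec.nat_le.comp Primrec.snd Primrec.fst)
      (Primrec.nat_mul.comp (Primrec.const 2) (Primrec.nat_sub.comp Primrec.fst Primrec.snd))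
      (Primrec.nat_sub.comp (Primrec.nat_mul.comp (Primrec.const 2)
        (Primrec.nat_sub.comp Primrec.snd Primrec.fst)) (Primrec.const 1))
  refine h.of_eq fun a b => ?_
  rw [encode_int]
  split_ifs <;> omega

theorem primrec_natCast : Primrec fun a : ℕ => (a : ℤ) :=
  (primrec_natCast_sub.comp Primrec.id (Primrec.const 0)).of_eq fun a => by simp

theorem primrec_int_add : Primrec₂ fun a b : ℤ => a + b := by
  have h : Primrec₂ fun a b : ℤ =>
      ((a.toNat + b.toNat : ℕ) : ℤ) - (((-a).toNat + (-b).toNat : ℕ) : ℤ) :=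
    primrec_natCast_sub.comp
      (Primrec.nat_add.comp (primrec_toNat.comp Primrec.fst) (primrec_toNat.comp Primrec.snd))
      (Primrec.nat_add.comp (primrec_toNat_neg.comp Primrec.fst)
        (primrec_toNat_neg.comp Primrec.snd))
  exact h.of_eq fun a b => by omega

theorem primrec_int_mul : Primrec₂ fun a b : ℤ => a * b := by
  have h : Primrec₂ fun a b : ℤ =>
      ((a.toNat * b.toNat + (-a).toNat * (-b).toNat : ℕ) : ℤ) -
        ((a.toNat * (-b).toNat + (-a).toNat * b.toNat : ℕ) : ℤ) :=
    primrec_natCast_sub.comp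
      (Primrec.nat_add.comp
        (Primrec.nat_mul.comp (primrec_toNat.comp Primrec.fst) (primrec_toNat.comp Primrec.snd))
        (Primrec.nat_mul.comp (primrec_toNat_neg.comp Primrec.fst)
          (primrec_toNat_neg.comp Primrec.snd)))
      (Primrec.nat_add.comp
        (Primrec.nat_mul.comp (primrec_toNat.comp Primrec.fst)
          (primrec_toNat_neg.comp Primrec.snd))
        (Primrec.nat_mul.comp (primrec_toNat_neg.comp Primrec.fst)
          (primrec_toNat.comp Primrec.snd)))
  refine h.of_eq fun a b => ?_
  have ha := Int.toNat_sub_toNat_neg a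
  have hb := Int.toNat_sub_toNat_neg b
  push_cast
  conv_rhs => rw [← ha, ← hb]
  ring

theorem primrec_nat_pow : Primrec₂ fun a b : ℕ => a ^ b :=
  Primrec₂.unpaired'.1 Nat.Primrec.pow

theorem primrec_sum_range {α : Type*} [Primcodable α] {n : α → ℕ} {f : α → ℕ → ℤ}
    (hn : Primrec n) (hf : Primrec₂ f) :
    Primrec fun a => ((List.range (n a)).map (f a)).sum := by
  have h := Primrec.list_foldr (Primrec.list_map (Primrec.list_range.comp hn) hf)
    (Primrec.const (0 : ℤ))
    (h := fun _ (p : ℤ × ℤ) => p.1 + p.2)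
    (primrec_int_add.comp (Primrec.fst.comp Primrec.snd) (Primrec.snd.comp Primrec.snd))
  exact h.of_eq fun a => rfl

/-- The `i`-th digit of `m` in base `b`. -/
def digit (b m i : ℕ) : ℕ := m / b ^ i % b

/-- The `j`-th coordinate of the combination of the vectors in `V` whose coefficients are the
digits of `m` in base `b`. -/
def digitComb (V : List (List ℤ)) (b m j : ℕ) : ℤ :=
  ((List.range V.length).map fun i => (digit b m i : ℤ) * (V.getD i []).getD j 0).sum

/-- The combination of the vectors in `V` whose coefficients are the digits of `m` in base `b`,
as the list of its first `d` coordinates. -/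
def digitPoint (d : ℕ) (V : List (List ℤ)) (b m : ℕ) : List ℤ :=
  (List.range d).map (digitComb V b m)

/-- The value at `v` of the linear functional with coefficients `h`. -/
def height (h v : List ℤ) : ℤ :=
  ((List.range v.length).map fun j => h.getD j 0 * v.getD j 0).sum

/-- The bounded search for a presentation of `v` as an element of the pair `p`. -/
def MemCode (d : ℕ) (h : List ℤ) (p : List ℤ × List (List ℤ)) (v : List ℤ) : Prop :=
  ∃ m < ((height h v).toNat + 1) ^ p.2.length,
    ∀ j < d, v.getD j 0 = p.1.getD j 0 + digitComb p.2 ((height h v).toNat + 1) m j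

/-- Inputs `(d, A, stdPairs I)` of the algorithm, coded by lists. -/
abbrev Input : Type := ℕ × List (List ℤ) × List (List ℤ × List (List ℤ))

/-- The point with number `m` of the box with side `M` lies in none of the given pairs. -/
def IsGenCode (x : Input) (c : ℕ × List ℤ) (m : ℕ) : Prop :=
  ∀ p ∈ x.2.2, ¬ MemCode x.1 c.2 p (digitPoint x.1 x.2.1 (c.1 + 1) m)

/-- The point with number `m` of the box with side `M` lies in one of the given pairs, together
with all the points obtained by increasing its coordinates that are equal to `M`. -/
def IsStdCode (x : Input) (c : ℕ × List ℤ) (m : ℕ) : Prop :=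
  ∃ p ∈ x.2.2, MemCode x.1 c.2 p (digitPoint x.1 x.2.1 (c.1 + 1) m) ∧
    ∀ i < x.2.1.length, digit (c.1 + 1) m i = c.1 → x.2.1.getD i [] ∈ p.2

/-- `c = (M, h)` certifies that the ideal is generated by the monomials from the box with
side `M`. -/
def Certifies (x : Input) (c : ℕ × List ℤ) : Prop :=
  (∀ l ∈ x.2.1, 1 ≤ height c.2 l) ∧
    ∀ m < (c.1 + 1) ^ x.2.1.length, IsStdCode x c m ∨ IsGenCode x c m

open Classical in
/-- The points of the box with side `M` that lie in none of the given pairs. -/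
noncomputable def output (x : Input) (c : ℕ × List ℤ) : List (List ℤ) :=
  ((List.range ((c.1 + 1) ^ x.2.1.length)).filter fun m => IsGenCode x c m).map
    (digitPoint x.1 x.2.1 (c.1 + 1))

open Classical in
/-- The algorithm: search for a certificate. -/
noncomputable def algorithm (x : Input) : Part (List (List ℤ)) :=
  Nat.rfindOpt fun n => (Encodable.decode (α := ℕ × List ℤ) n).bind fun c =>
    if Certifies x c then some (output x c) else none

section

variable {α : Type*} [Primcodable α]

theorem primrec_digit {b m i : α → ℕ} (hb : Primrec b) (hm : Primrec m) (hi : Primrec i) :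
    Primrec fun a => digit (b a) (m a) (i a) :=
  Primrec.nat_mod.comp (Primrec.nat_div.comp hm (primrec_nat_pow.comp hb hi)) hb

theorem primrec_digitComb {V : α → List (List ℤ)} {b m j : α → ℕ} (hV : Primrec V)
    (hb : Primrec b) (hm : Primrec m) (hj : Primrec j) :
    Primrec fun a => digitComb (V a) (b a) (m a) (j a) :=
  primrec_sum_range (Primrec.list_length.comp hV)
    (primrec_int_mul.comp
      (primrec_natCast.comp (primrec_digit (hb.comp Primrec.fst) (hm.comp Primrec.fst) Primrec.snd))
      ((Primrec.list_getD 0).comp ((Primrec.list_getD []).comp (hV.comp Primrec.fst) Primrec.snd)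
        (hj.comp Primrec.fst)))

theorem primrec_digitPoint {d b m : α → ℕ} {V : α → List (List ℤ)} (hd : Primrec d)
    (hV : Primrec V) (hb : Primrec b) (hm : Primrec m) :
    Primrec fun a => digitPoint (d a) (V a) (b a) (m a) :=
  Primrec.list_map (Primrec.list_range.comp hd)
    (primrec_digitComb (hV.comp Primrec.fst) (hb.comp Primrec.fst) (hm.comp Primrec.fst)
      Primrec.snd)

theorem primrec_height {h v : α → List ℤ} (hh : Primrec h) (hv : Primrec v) :
    Primrec fun a => height (h a) (v a) :=
  primrec_sum_range (Primrec.list_length.comp hv)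
    (primrec_int_mul.comp ((Primrec.list_getD 0).comp (hh.comp Primrec.fst) Primrec.snd)
      ((Primrec.list_getD 0).comp (hv.comp Primrec.fst) Primrec.snd))

theorem primrecPred_exists_mem {β : Type*} [Primcodable β] {l : α → List β} {R : α → β → Prop}
    (hl : Primrec l) (hR : PrimrecPred fun q : α × β => R q.1 q.2) : PrimrecPred fun a => ∃ x ∈ l a, R a x :=
  (PrimrecRel.exists_mem_list (R := fun x a => R a x)
    (hR.comp (Primrec.pair Primrec.snd Primrec.fst))).comp hl Primrec.id

theorem primrecPred_forall_mem {β : Type*} [Primcodable β] {l : α → List β} {R : α → β → Prop}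
    (hl : Primrec l) (hR : PrimrecPred fun q : α × β => R q.1 q.2) : PrimrecPred fun a => ∀ x ∈ l a, R a x :=
  (PrimrecRel.forall_mem_list (R := fun x a => R a x)
    (hR.comp (Primrec.pair Primrec.snd Primrec.fst))).comp hl Primrec.id

theorem primrecPred_exists_lt {n : α → ℕ} {R : α → ℕ → Prop} (hn : Primrec n)
    (hR : PrimrecPred fun q : α × ℕ => R q.1 q.2) : PrimrecPred fun a => ∃ x < n a, R a x :=
  (primrecPred_exists_mem (Primrec.list_range.comp hn) hR).of_eq fun a => by simp

theorem primrecPred_forall_lt {n : α → ℕ} {R : α → ℕ → Prop} (hn : Primrec n)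
    (hR : PrimrecPred fun q : α × ℕ => R q.1 q.2) : PrimrecPred fun a => ∀ x < n a, R a x :=
  (primrecPred_forall_mem (Primrec.list_range.comp hn) hR).of_eq fun a => by simp

theorem primrecPred_one_le {f : α → ℤ} (hf : Primrec f) : PrimrecPred fun a => 1 ≤ f a :=
  (Primrec.nat_le.comp (Primrec.const 1) (primrec_toNat.comp hf)).of_eq fun a => by omega

theorem primrecPred_memCode {d : α → ℕ} {h v : α → List ℤ} {p : α → List ℤ × List (List ℤ)}
    (hd : Primrec d) (hh : Primrec h) (hp : Primrec p) (hv : Primrec v) :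
    PrimrecPred fun a => MemCode (d a) (h a) (p a) (v a) := by
  have hb : Primrec fun a => (height (h a) (v a)).toNat + 1 :=
    Primrec.succ.comp (primrec_toNat.comp (primrec_height hh hv))
  refine primrecPred_exists_lt
    (primrec_nat_pow.comp hb (Primrec.list_length.comp (Primrec.snd.comp hp)))
    ((primrecPred_forall_lt (hd.comp Primrec.fst)
      (?_)))
  have h1 : Primrec fun a : (α × ℕ) × ℕ => a.1.1 := Primrec.fst.comp Primrec.fst
  exact Primrec.eq.comp ((Primrec.list_getD 0).comp (hv.comp h1) Primrec.snd)
    (primrec_int_add.comp ((Primrec.list_getD 0).comp (Primrec.fst.comp (hp.comp h1)) Primrec.snd)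
      (primrec_digitComb (Primrec.snd.comp (hp.comp h1)) (hb.comp h1)
        (Primrec.snd.comp Primrec.fst) Primrec.snd))

theorem primrecPred_isGenCode {x : α → Input} {c : α → ℕ × List ℤ} {m : α → ℕ} (hx : Primrec x)
    (hc : Primrec c) (hm : Primrec m) : PrimrecPred fun a => IsGenCode (x a) (c a) (m a) := by
  refine primrecPred_forall_mem (Primrec.snd.comp (Primrec.snd.comp hx))
    ((PrimrecPred.not ?_))
  have hx' := hx.comp (Primrec.fst (β := List ℤ × List (List ℤ)))
  have hc' := hc.comp (Primrec.fst (β := List ℤ × List (List ℤ)))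
  exact primrecPred_memCode (Primrec.fst.comp hx') (Primrec.snd.comp hc') Primrec.snd
    (primrec_digitPoint (Primrec.fst.comp hx') (Primrec.fst.comp (Primrec.snd.comp hx'))
      (Primrec.succ.comp (Primrec.fst.comp hc')) (hm.comp Primrec.fst))

theorem primrecPred_isStdCode {x : α → Input} {c : α → ℕ × List ℤ} {m : α → ℕ} (hx : Primrec x)
    (hc : Primrec c) (hm : Primrec m) : PrimrecPred fun a => IsStdCode (x a) (c a) (m a) := by
  refine primrecPred_exists_mem (Primrec.snd.comp (Primrec.snd.comp hx))
    ((PrimrecPred.and ?_ ?_))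
  · have hx' := hx.comp (Primrec.fst (β := List ℤ × List (List ℤ)))
    have hc' := hc.comp (Primrec.fst (β := List ℤ × List (List ℤ)))
    exact primrecPred_memCode (Primrec.fst.comp hx') (Primrec.snd.comp hc') Primrec.snd
      (primrec_digitPoint (Primrec.fst.comp hx') (Primrec.fst.comp (Primrec.snd.comp hx'))
        (Primrec.succ.comp (Primrec.fst.comp hc')) (hm.comp Primrec.fst))
  · have hL : Primrec fun a => (x a).2.1 := Primrec.fst.comp (Primrec.snd.comp hx)
    refine primrecPred_forall_lt (Primrec.list_length.comp (hL.comp Primrec.fst))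
      (?_)
    have h1 : Primrec fun a : (α × List ℤ × List (List ℤ)) × ℕ => a.1.1 :=
      Primrec.fst.comp Primrec.fst
    have hM := (Primrec.fst.comp hc).comp h1
    have hmem : PrimrecPred fun a : (α × List ℤ × List (List ℤ)) × ℕ =>
        (x a.1.1).2.1.getD a.2 [] ∈ a.1.2.2 :=
      (primrecPred_exists_mem (R := fun (a : (α × List ℤ × List (List ℤ)) × ℕ) v =>
        (x a.1.1).2.1.getD a.2 [] = v) (Primrec.snd.comp (Primrec.snd.comp Primrec.fst))
        ((Primrec.eq.comp
          ((Primrec.list_getD []).comp (hL.comp (h1.comp Primrec.fst))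
            (Primrec.snd.comp Primrec.fst)) Primrec.snd))).of_eq fun a => by simp
    exact ((PrimrecPred.not (Primrec.eq.comp
      (primrec_digit (Primrec.succ.comp hM) (hm.comp h1) Primrec.snd) hM)).or hmem).of_eq
      fun a => by rw [imp_iff_not_or]

theorem primrecPred_certifies {x : α → Input} {c : α → ℕ × List ℤ} (hx : Primrec x)
    (hc : Primrec c) : PrimrecPred fun a => Certifies (x a) (c a) := by
  have hL : Primrec fun a => (x a).2.1 := Primrec.fst.comp (Primrec.snd.comp hx)
  exact (primrecPred_forall_mem hL ((primrecPred_one_le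
      (primrec_height (Primrec.snd.comp (hc.comp Primrec.fst)) Primrec.snd)))).and
    (primrecPred_forall_lt (primrec_nat_pow.comp (Primrec.succ.comp (Primrec.fst.comp hc))
        (Primrec.list_length.comp hL))
      (
        ((primrecPred_isStdCode (hx.comp Primrec.fst) (hc.comp Primrec.fst) Primrec.snd).or
          (primrecPred_isGenCode (hx.comp Primrec.fst) (hc.comp Primrec.fst) Primrec.snd))))

theorem primrec_output {x : α → Input} {c : α → ℕ × List ℤ} (hx : Primrec x)
    (hc : Primrec c) : Primrec fun a => output (x a) (c a) := by
  classical
  have hL : Primrec fun a => (x a).2.1 := Primrec.fst.comp (Primrec.snd.comp hx)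
  have h : Primrec fun a => ((List.range (((c a).1 + 1) ^ (x a).2.1.length)).filterMap fun m =>
      if IsGenCode (x a) (c a) m then some (digitPoint (x a).1 (x a).2.1 ((c a).1 + 1) m)
      else none) :=
    Primrec.listFilterMap (Primrec.list_range.comp (primrec_nat_pow.comp
        (Primrec.succ.comp (Primrec.fst.comp hc)) (Primrec.list_length.comp hL)))
      (Primrec.ite (primrecPred_isGenCode (hx.comp Primrec.fst) (hc.comp Primrec.fst) Primrec.snd)
        (Primrec.option_some.comp (primrec_digitPoint (Primrec.fst.comp (hx.comp Primrec.fst))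
          (hL.comp Primrec.fst) (Primrec.succ.comp (Primrec.fst.comp (hc.comp Primrec.fst)))
          Primrec.snd)) (Primrec.const none))
  refine h.of_eq fun a => ?_
  rw [output, ← List.filterMap_eq_map, ← List.filterMap_eq_filter, List.filterMap_filterMap]
  refine congrArg (fun f => List.filterMap f _) (funext fun m => ?_)
  by_cases hm : IsGenCode (x a) (c a) m <;> simp [hm, Option.guard]

end

theorem partrec_algorithm : Partrec algorithm := by
  classical
  refine Partrec.rfindOpt (Primrec.to_comp ?_)
  refine Primrec.option_bind (Primrec.decode.comp Primrec.snd) ?_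
  have hx : Primrec fun a : (Input × ℕ) × ℕ × List ℤ => a.1.1 := Primrec.fst.comp Primrec.fst
  exact Primrec.ite (primrecPred_certifies hx Primrec.snd)
    (Primrec.option_some.comp (primrec_output hx Primrec.snd)) (Primrec.const none)

theorem exists_certifies_of_mem_algorithm {x : Input} {y : List (List ℤ)} (h : y ∈ algorithm x) :
    ∃ c, Certifies x c ∧ output x c = y := by
  obtain ⟨n, hn⟩ := Nat.rfindOpt_spec h
  obtain ⟨c, -, hc⟩ := Option.bind_eq_some_iff.1 hn
  split_ifs at hc with hc'
  exact ⟨c, hc', Option.some.inj hc⟩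

theorem algorithm_dom {x : Input} {c : ℕ × List ℤ} (h : Certifies x c) : (algorithm x).Dom :=
  Nat.rfindOpt_dom.2 ⟨Encodable.encode c, output x c, by
    rw [Encodable.encodek, Option.bind_some, if_pos h]; rfl⟩

end Computability

/-! ### Cones, integral functionals and smallest faces. -/

section Geometry

/-- Finitely many real numbers can be replaced by integers that satisfy the same homogeneous linear
relations with integer coefficients, so that positive numbers become positive integers. -/
theorem exists_int_of_real {ι : Type*} [Fintype ι] (r : ι → ℝ) :
    ∃ n : ι → ℤ, (∀ i, 0 < r i → 0 < n i) ∧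
      ∀ m : ι → ℤ, ∑ i, (m i : ℝ) * r i = 0 → ∑ i, m i * n i = 0 := by
  -- This group is finitely generated and torsion-free, hence free. Any additive map `W → ℤ`
  -- preserves the integral relations; only positivity needs care.
  let W := Submodule.span ℤ (Set.range r)
  have : Module.Finite ℤ W := Module.Finite.span_of_finite ℤ (Set.finite_range r)
  have : Module.Free ℤ W := Module.free_of_finite_type_torsion_free'
  let e := Module.Free.chooseBasis ℤ W
  let x : ι → W := fun i => ⟨r i, Submodule.subset_span ⟨i, rfl⟩⟩
  have hN : ∃ N : ℕ, ∀ i, 0 < r i → ∑ j, |(e.repr (x i) j : ℝ)| < N * r i := by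
    have : ∀ᶠ N : ℕ in Filter.atTop, ∀ i, 0 < r i → ∑ j, |(e.repr (x i) j : ℝ)| < N * r i := by
      refine Filter.eventually_all.2 fun i => ?_
      by_cases hi : 0 < r i
      · filter_upwards [(tendsto_natCast_atTop_atTop.atTop_mul_const hi).eventually_gt_atTop
          (∑ j, |(e.repr (x i) j : ℝ)|)] with N hN _ using hN
      · exact Filter.Eventually.of_forall fun N h => absurd h hi
    exact this.exists
  obtain ⟨N, hN⟩ := hN
  -- Rounding `N • e j` changes the value at `r i` by at most the sum of the absolute coordinates of
  -- `r i`, which `N` was chosen to beat.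
  let φ : W →ₗ[ℤ] ℤ := e.constr ℤ fun j => ⌊(N : ℝ) * (e j : ℝ)⌋
  refine ⟨fun i => φ (x i), fun i hi => ?_, fun m hm => ?_⟩
  · have h1 : φ (x i) = ∑ j, e.repr (x i) j * ⌊(N : ℝ) * (e j : ℝ)⌋ := by
      simp [φ, Module.Basis.constr_apply_fintype]
    have h2 : r i = ∑ j, (e.repr (x i) j : ℝ) * (e j : ℝ) := by
      have := congrArg W.subtype (e.sum_repr (x i))
      simp only [map_sum, map_smul, Submodule.subtype_apply, zsmul_eq_mul] at this
      exact this.symm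
    have h3 : (N : ℝ) * r i - ∑ j, |(e.repr (x i) j : ℝ)| ≤ (φ (x i) : ℝ) := by
      rw [h1, h2, Finset.mul_sum, ← Finset.sum_sub_distrib]
      push_cast
      refine Finset.sum_le_sum fun j _ => ?_
      have hf0 := Int.floor_le ((N : ℝ) * (e j : ℝ))
      have hf1 := Int.lt_floor_add_one ((N : ℝ) * (e j : ℝ))
      have h4 : (e.repr (x i) j : ℝ) * (N * (e j : ℝ) - ⌊(N : ℝ) * (e j : ℝ)⌋) ≤
          |(e.repr (x i) j : ℝ)| * 1 := by
        refine (le_abs_self _).trans ?_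
        rw [abs_mul]
        refine mul_le_mul_of_nonneg_left ?_ (abs_nonneg _)
        rw [abs_le]
        constructor <;> linarith
      linarith
    have h4 : (0 : ℝ) < φ (x i) := by linarith [hN i hi]
    exact_mod_cast h4
  · have h1 : ∑ i, m i • x i = 0 := by
      apply Subtype.ext
      simpa [x] using hm
    have h2 := congrArg φ h1
    simpa using h2

variable {d : ℕ}

/-- A lattice point as a point of `ℝ^d`. -/
abbrev castVec (v : Fin d → ℤ) : Fin d → ℝ := fun i => (v i : ℝ)

theorem castVec_add (v w : Fin d → ℤ) : castVec (v + w) = castVec v + castVec w :=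
  funext fun i => Int.cast_add (v i) (w i)

theorem castVec_mem_cone {A : Finset (Fin d → ℤ)} {a : Fin d → ℤ} (ha : a ∈ A) :
    castVec a ∈ cone A :=
  Submodule.subset_span ⟨a, ha, rfl⟩

theorem smul_mem_cone {A : Finset (Fin d → ℤ)} {x : Fin d → ℝ} {c : ℝ} (hc : 0 ≤ c)
    (hx : x ∈ cone A) : c • x ∈ cone A :=
  (cone A).smul_mem hc hx

theorem mem_cone_iff {A : Finset (Fin d → ℤ)} {x : Fin d → ℝ} :
    x ∈ cone A ↔ ∃ c : A → ℝ, (∀ a, 0 ≤ c a) ∧ x = ∑ a, c a • castVec a.1 := by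
  constructor
  · intro hx
    obtain ⟨c, hc⟩ := (Submodule.mem_span_image_finset_iff_exists_fun _).1 hx
    exact ⟨fun a => (c a : ℝ), fun a => (c a).2, hc.symm⟩
  · rintro ⟨c, hc, rfl⟩
    exact sum_mem fun a _ => smul_mem_cone (hc a) (castVec_mem_cone a.2)

/-- In a vanishing convex combination, the negative of a term with positive weight is the sum of the
others, so the cone would contain a line unless that term is zero. -/
theorem zero_notMem_convexHull {A : Finset (Fin d → ℤ)} (hA : IsConfiguration A) :
    (0 : Fin d → ℝ) ∉ convexHull ℝ (castVec '' (A : Set (Fin d → ℤ))) := by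
  classical
  intro h
  rw [← Finset.coe_image, Finset.mem_convexHull'] at h
  obtain ⟨w, hw0, hw1, hw⟩ := h
  obtain ⟨y, hy, hwy⟩ : ∃ y ∈ A.image castVec, 0 < w y := by
    by_contra! hc
    linarith [Finset.sum_nonpos hc]
  have hcone : ∀ z ∈ A.image castVec, z ∈ cone A := fun z hz => by
    obtain ⟨a, ha, rfl⟩ := Finset.mem_image.1 hz
    exact castVec_mem_cone ha
  have h0 : w y • y = 0 := by
    refine hA.stronglyConvex _ (smul_mem_cone hwy.le (hcone y hy)) ?_
    rw [← Finset.add_sum_erase _ _ hy] at hw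
    rw [neg_eq_of_add_eq_zero_right hw]
    exact sum_mem fun z hz => smul_mem_cone (hw0 z (Finset.mem_of_mem_erase hz))
      (hcone z (Finset.mem_of_mem_erase hz))
  obtain ⟨a, ha, rfl⟩ := Finset.mem_image.1 hy
  have ha0 : a = 0 := by
    ext i
    have := congrFun ((smul_eq_zero.1 h0).resolve_left hwy.ne') i
    simpa using this
  exact hA.zero_notMem (ha0 ▸ ha)

/-- A configuration has an integral linear functional that is positive on it. -/
theorem exists_positive_functional {A : Finset (Fin d → ℤ)} (hA : IsConfiguration A) :
    ∃ h : Fin d → ℤ, ∀ a ∈ A, 1 ≤ ∑ j, h j * a j := by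
  classical
  obtain ⟨f, u, hf, hu⟩ := geometric_hahn_banach_closed_point
    (convex_convexHull ℝ (castVec '' (A : Set (Fin d → ℤ))))
    ((A.finite_toSet.image castVec).isClosed_convexHull ℝ) (zero_notMem_convexHull hA)
  have hneg : ∀ a ∈ A, 0 < -f (castVec a) := fun a ha => by
    have := hf _ (subset_convexHull ℝ _ ⟨a, ha, rfl⟩)
    rw [map_zero] at hu
    linarith
  -- The values at the points of `A` are included as extra numbers: that they are integral
  -- combinations of the values at the basis vectors is a relation that survives, and so does their
  -- positivity.
  obtain ⟨n, hn, hrel⟩ := exists_int_of_real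
    (Sum.elim (fun j : Fin d => -f (Pi.single j 1)) fun a : A => -f (castVec a.1))
  refine ⟨fun j => n (Sum.inl j), fun a ha => ?_⟩
  have h1 : 0 < n (Sum.inr ⟨a, ha⟩) := hn _ (hneg a ha)
  have h2 := hrel (Sum.elim a fun b => if b = ⟨a, ha⟩ then -1 else 0) (by
    have h3 : f (castVec a) = ∑ j, (a j : ℝ) * f (Pi.single j 1) := by
      conv_lhs => rw [← Finset.univ_sum_single (castVec a), map_sum]
      refine Finset.sum_congr rfl fun j _ => ?_
      rw [← smul_eq_mul, ← map_smul, ← Pi.single_smul, smul_eq_mul, mul_one]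
    simp [Fintype.sum_sum_type, h3])
  simp only [Fintype.sum_sum_type, Sum.elim_inl, Sum.elim_inr, ite_mul, neg_one_mul, zero_mul,
    Finset.sum_ite_eq', Finset.mem_univ, if_true] at h2
  have h3 : ∑ j, n (Sum.inl j) * a j = ∑ j, a j * n (Sum.inl j) :=
    Finset.sum_congr rfl fun j _ => mul_comm _ _
  change 1 ≤ ∑ j, n (Sum.inl j) * a j
  omega

/-- If `a + y` lies in the cone of `S` for some `y` in the cone of `A`, then `a` divides an element
of the semigroup of `S`. -/
theorem exists_add_mem_semigroup {A S : Finset (Fin d → ℤ)} {a : Fin d → ℤ} (ha : a ∈ A)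
    {y : Fin d → ℝ} (hy : y ∈ cone A) (hay : castVec a + y ∈ cone S) :
    ∃ g ∈ semigroup A, a + g ∈ semigroup S := by
  obtain ⟨c, hc, rfl⟩ := mem_cone_iff.1 hy
  obtain ⟨t, ht, hEq⟩ := mem_cone_iff.1 hay
  -- The number `1` is the coefficient of `a`. It becomes a positive integer, so one copy of `a` can
  -- be split off and the rest taken as `g`.
  obtain ⟨n, hn, hrel⟩ := exists_int_of_real (Sum.elim (fun _ : Unit => (1 : ℝ)) (Sum.elim c t))
  have hzero : ∀ i, (Sum.elim (fun _ : Unit => (1 : ℝ)) (Sum.elim c t)) i = 0 → n i = 0 := by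
    classical
    intro i hi
    have h := hrel (Pi.single i 1) (by
      rw [Finset.sum_eq_single i (fun j _ hj => by simp [hj]) (by simp), hi, mul_zero])
    rwa [Finset.sum_eq_single i (fun j _ hj => by simp [hj]) (by simp), Pi.single_eq_same,
      one_mul] at h
  have hnonneg : ∀ i, 0 ≤ (Sum.elim (fun _ : Unit => (1 : ℝ)) (Sum.elim c t)) i → 0 ≤ n i :=
    fun i hi => hi.lt_or_eq.elim (fun h => (hn i h).le) fun h => (hzero i h.symm).ge
  have h1 : 0 < n (Sum.inl ()) := hn _ (by simp)
  have hvec : n (Sum.inl ()) • a + ∑ b : A, n (Sum.inr (Sum.inl b)) • b.1 =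
      ∑ s : S, n (Sum.inr (Sum.inr s)) • s.1 := by
    ext j
    have h2 := hrel (Sum.elim (fun _ => a j) (Sum.elim (fun b => b.1 j) fun s => -s.1 j)) (by
      have h3 := congrFun hEq j
      simp only [Pi.add_apply, Finset.sum_apply, Pi.smul_apply, smul_eq_mul] at h3
      simp only [Fintype.sum_sum_type, Sum.elim_inl, Sum.elim_inr, Finset.univ_unique,
        Finset.sum_singleton, Int.cast_neg, neg_mul, Finset.sum_neg_distrib, mul_one]
      simp only [mul_comm (c _), mul_comm (t _)] at h3
      linarith)
    simp only [Fintype.sum_sum_type, Sum.elim_inl, Sum.elim_inr, Finset.univ_unique,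
      Finset.sum_singleton, neg_mul, Finset.sum_neg_distrib] at h2
    simp only [Pi.add_apply, Finset.sum_apply, Pi.smul_apply, smul_eq_mul, mul_comm (n _)]
    linarith!
  have hsmul : ∀ (B : Finset (Fin d → ℤ)) (z : ℤ) (b : Fin d → ℤ), 0 ≤ z → b ∈ B →
      z • b ∈ semigroup B := fun B z b hz hb => by
    lift z to ℕ using hz
    rw [natCast_zsmul]
    exact nsmul_mem (AddSubmonoid.subset_closure hb) _
  refine ⟨(n (Sum.inl ()) - 1) • a + ∑ b : A, n (Sum.inr (Sum.inl b)) • b.1,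
    add_mem (hsmul A _ _ (by omega) ha)
      (sum_mem fun b _ => hsmul A _ _ (hnonneg _ (hc b)) b.2), ?_⟩
  have h2 : a + ((n (Sum.inl ()) - 1) • a + ∑ b : A, n (Sum.inr (Sum.inl b)) • b.1) =
      ∑ s : S, n (Sum.inr (Sum.inr s)) • s.1 := by
    rw [← hvec, sub_smul, one_smul]
    abel
  rw [h2]
  exact sum_mem fun s _ => hsmul S _ _ (hnonneg _ (ht s)) s.2

theorem castVec_mem_cone_of_mem_semigroup {A : Finset (Fin d → ℤ)} {v : Fin d → ℤ}
    (hv : v ∈ semigroup A) : castVec v ∈ cone A := by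
  induction hv using AddSubmonoid.closure_induction with
  | mem x hx => exact castVec_mem_cone hx
  | zero =>
    have : castVec (0 : Fin d → ℤ) = 0 := by ext; simp
    rw [this]
    exact zero_mem _
  | add x y _ _ hx hy =>
    rw [castVec_add]
    exact add_mem hx hy

theorem cone_mono {A B : Finset (Fin d → ℤ)} (h : A ⊆ B) : cone A ≤ cone B :=
  Submodule.span_mono (Set.image_mono (Finset.coe_subset.2 h))

/-- The smallest face of `A` that contains `S`: the elements of `A` that divide an element of the
semigroup of `S`. -/
theorem exists_face {A S : Finset (Fin d → ℤ)} (hS : S ⊆ A) :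
    ∃ F, IsFace A F ∧ S ⊆ F ∧ ∀ f ∈ semigroup F, ∃ g ∈ semigroup A, f + g ∈ semigroup S := by
  classical
  let F := A.filter fun a => ∃ g ∈ semigroup A, a + g ∈ semigroup S
  have hFA : F ⊆ A := Finset.filter_subset _ _
  have hF : ∀ f ∈ semigroup F, ∃ g ∈ semigroup A, f + g ∈ semigroup S := by
    intro f hf
    induction hf using AddSubmonoid.closure_induction with
    | mem x hx => exact (Finset.mem_filter.1 hx).2
    | zero => exact ⟨0, zero_mem _, by simp⟩
    | add x y _ _ hx hy =>
      obtain ⟨g, hg, hg'⟩ := hx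
      obtain ⟨g', hg1, hg2⟩ := hy
      exact ⟨g + g', add_mem hg hg1, by rw [add_add_add_comm]; exact add_mem hg' hg2⟩
  -- The real form of divisibility, needed for both face axioms; `exists_add_mem_semigroup` leads
  -- back to lattice points.
  have hcone : ∀ z ∈ cone F, ∃ y ∈ cone A, z + y ∈ cone S := by
    intro z hz
    obtain ⟨c, hc, rfl⟩ := mem_cone_iff.1 hz
    choose g hg hg' using fun f : F => (Finset.mem_filter.1 f.2).2
    refine ⟨∑ f : F, c f • castVec (g f), sum_mem fun f _ => smul_mem_cone (hc f)
      (castVec_mem_cone_of_mem_semigroup (hg f)), ?_⟩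
    rw [← Finset.sum_add_distrib]
    refine sum_mem fun f _ => ?_
    rw [← smul_add, ← castVec_add]
    exact smul_mem_cone (hc f) (castVec_mem_cone_of_mem_semigroup (hg' f))
  refine ⟨F, ⟨hFA, ⟨cone_mono hFA, ?_⟩, ?_⟩, ?_, hF⟩
  · intro x y α hx hy hα hxy
    obtain ⟨y', hy', hxy'⟩ := hcone _ hxy
    obtain ⟨c, hc, rfl⟩ := mem_cone_iff.1 hx
    refine sum_mem fun a _ => ?_
    rcases (hc a).eq_or_lt with h0 | hpos
    · rw [← h0, zero_smul]
      exact zero_mem _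
    refine smul_mem_cone (hc a) (castVec_mem_cone (Finset.mem_filter.2 ⟨a.2, ?_⟩))
    have hac : 0 < α * c a := mul_pos hα hpos
    -- Isolate the term `(α * c a) • a` in the point of `cone S` and divide by its coefficient; the
    -- remaining summands lie in `cone A`.
    refine exists_add_mem_semigroup a.2
      (y := (α * c a)⁻¹ • (α • (∑ b ∈ Finset.univ.erase a, c b • castVec b.1) + (y + y')))
      (smul_mem_cone (inv_pos.2 hac).le (add_mem (smul_mem_cone hα.le
        (sum_mem fun b _ => smul_mem_cone (hc b) (castVec_mem_cone b.2))) (add_mem hy hy'))) ?_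
    convert smul_mem_cone (inv_pos.2 hac).le hxy' using 1
    rw [← Finset.add_sum_erase _ _ (Finset.mem_univ a)]
    rw [add_assoc, smul_add α, smul_smul α, add_assoc, smul_add _ ((α * c a) • _),
      inv_smul_smul₀ hac.ne']
  · intro v hv hvF
    obtain ⟨y, hy, hvy⟩ := hcone _ hvF
    exact Finset.mem_filter.2 ⟨hv, exists_add_mem_semigroup hv hy hvy⟩
  · exact fun s hs => Finset.mem_filter.2 ⟨hS hs, 0, zero_mem _, by
      rw [add_zero]; exact AddSubmonoid.subset_closure hs⟩

end Geometry

/-! ### Monomial ideals and their monomials. -/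

section Ideals

variable {k : Type*} [Field k] {d : ℕ} {A : Finset (Fin d → ℤ)}

/-- The degree map `ℕA → ℤ^d` is injective, so a homogeneous component consists of a single term. -/
theorem decompose_gradeBy (x : SemigroupRing k A) (a : semigroup A) :
    (DirectSum.decompose (AddMonoidAlgebra.gradeBy k (semigroup A).subtype) x a.1 :
      SemigroupRing k A) = AddMonoidAlgebra.single a (x.coeff a) := by
  classical
  induction x using AddMonoidAlgebra.induction_linear with
  | zero => rw [DirectSum.decompose_zero, DirectSum.zero_apply]; simp
  | add x y hx hy =>
    rw [DirectSum.decompose_add, DirectSum.add_apply, Submodule.coe_add, hx, hy]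
    simp
  | single b r =>
    have h := DirectSum.decompose_of_mem (AddMonoidAlgebra.gradeBy k (semigroup A).subtype)
      (AddMonoidAlgebra.single_mem_gradeBy (semigroup A).subtype b r)
    rw [h]
    by_cases hab : b = a
    · subst hab
      erw [DirectSum.of_eq_same]
      simp
    · rw [DirectSum.of_eq_of_ne]
      · simp [hab]
      · exact fun h => hab (Subtype.ext h.symm)

theorem single_mem_iff {I : Ideal (SemigroupRing k A)} {a : semigroup A} {r : k} (hr : r ≠ 0) :
    (AddMonoidAlgebra.single a r : SemigroupRing k A) ∈ I ↔ monomial k A a ∈ I := by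
  constructor <;> intro h
  · have := I.mul_mem_left (AddMonoidAlgebra.single 0 r⁻¹) h
    rwa [AddMonoidAlgebra.single_mul_single, zero_add, inv_mul_cancel₀ hr] at this
  · have := I.mul_mem_left (AddMonoidAlgebra.single 0 r) h
    rwa [monomial, AddMonoidAlgebra.single_mul_single, zero_add, mul_one] at this

/-- A monomial ideal is contained in every ideal that contains its monomials. -/
theorem IsMonomialIdeal.le_of_monomial_mem {I J : Ideal (SemigroupRing k A)}
    (hI : IsMonomialIdeal I) (h : ∀ a, monomial k A a ∈ I → monomial k A a ∈ J) : I ≤ J := by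
  intro x hx
  rw [← AddMonoidAlgebra.sum_coeff_single x]
  refine sum_mem fun a ha => ?_
  have hr : x.coeff a ≠ 0 := Finsupp.mem_support_iff.1 ha
  refine (single_mem_iff hr).2 (h a ((single_mem_iff hr).1 ?_))
  rw [← decompose_gradeBy]
  exact (Ideal.IsHomogeneous.mem_iff _ hI).1 hx a.1

theorem monomial_add_mem {I : Ideal (SemigroupRing k A)} {a : semigroup A} (b : semigroup A)
    (h : monomial k A a ∈ I) : monomial k A (a + b) ∈ I := by
  have := I.mul_mem_right (monomial k A b) h
  rwa [monomial, monomial, AddMonoidAlgebra.single_mul_single, mul_one] at this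

variable {I : Ideal (SemigroupRing k A)}

theorem mem_stdMono_iff (a : semigroup A) : a.1 ∈ stdMono I ↔ monomial k A a ∉ I :=
  ⟨fun ⟨_, h⟩ => h, fun h => ⟨a.2, h⟩⟩

theorem mem_stdMono_of_add_mem {a b : Fin d → ℤ} (ha : a ∈ semigroup A) (hb : b ∈ semigroup A)
    (h : a + b ∈ stdMono I) : a ∈ stdMono I :=
  ⟨ha, fun h' => h.2 (monomial_add_mem ⟨b, hb⟩ h')⟩

end Ideals

/-! ### Nonnegative combinations and heights. -/

section Combinations

variable {d : ℕ}

theorem dotProduct_nonneg {A : Finset (Fin d → ℤ)} {h : Fin d → ℤ} (hh : ∀ a ∈ A, 1 ≤ h ⬝ᵥ a)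
    {v : Fin d → ℤ} (hv : v ∈ semigroup A) : 0 ≤ h ⬝ᵥ v := by
  induction hv using AddSubmonoid.closure_induction with
  | mem x hx => exact zero_le_one.trans (hh x hx)
  | zero => simp
  | add x y _ _ hx hy => rw [dotProduct_add]; exact add_nonneg hx hy

theorem eq_zero_of_dotProduct_nonpos {A : Finset (Fin d → ℤ)} {h : Fin d → ℤ}
    (hh : ∀ a ∈ A, 1 ≤ h ⬝ᵥ a) {v : Fin d → ℤ} (hv : v ∈ semigroup A) : h ⬝ᵥ v ≤ 0 → v = 0 := by
  induction hv using AddSubmonoid.closure_induction with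
  | mem x hx => intro h0; linarith [hh x hx]
  | zero => simp
  | add x y hx hy hx' hy' =>
    intro h0
    rw [dotProduct_add] at h0
    have h1 := dotProduct_nonneg hh hx
    have h2 := dotProduct_nonneg hh hy
    rw [hx' (by linarith), hy' (by linarith), add_zero]

/-- The combination of the vectors in `V` with coefficients `c`. -/
def comb (V : List (Fin d → ℤ)) (c : Fin V.length → ℕ) : Fin d → ℤ :=
  ∑ i, c i • V.get i

theorem mem_semigroup_toFinset_iff {V : List (Fin d → ℤ)} {v : Fin d → ℤ} :
    v ∈ semigroup V.toFinset ↔ ∃ c, v = comb V c := by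
  have : (V.toFinset : Set (Fin d → ℤ)) = Set.range V.get := by
    ext x
    simp [List.mem_iff_get]
  rw [semigroup, this]
  exact AddSubmonoid.mem_closure_range_iff_of_fintype

theorem comb_add (V : List (Fin d → ℤ)) (c c' : Fin V.length → ℕ) :
    comb V (c + c') = comb V c + comb V c' := by
  simp [comb, add_smul, Finset.sum_add_distrib]

theorem comb_mem {V : List (Fin d → ℤ)} (c : Fin V.length → ℕ) :
    comb V c ∈ semigroup V.toFinset :=
  mem_semigroup_toFinset_iff.2 ⟨c, rfl⟩

theorem comb_mem_of_support {V : List (Fin d → ℤ)} {F : Finset (Fin d → ℤ)} {c : Fin V.length → ℕ}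
    (h : ∀ i, c i ≠ 0 → V.get i ∈ F) : comb V c ∈ semigroup F := by
  refine sum_mem fun i _ => ?_
  by_cases hi : c i = 0
  · rw [hi, zero_smul]
    exact zero_mem _
  · exact nsmul_mem (AddSubmonoid.subset_closure (h i hi)) _

/-- Each generator has height at least `1` and no term has negative height. This bound makes
membership in a pair a finite search. -/
theorem coeff_le_dotProduct_comb {V : List (Fin d → ℤ)} {h : Fin d → ℤ}
    (hh : ∀ a ∈ V, 1 ≤ h ⬝ᵥ a) (c : Fin V.length → ℕ) (i : Fin V.length) :
    (c i : ℤ) ≤ h ⬝ᵥ comb V c := by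
  have hpos : ∀ j, (c j : ℤ) ≤ h ⬝ᵥ (c j • V.get j) := fun j => by
    rw [dotProduct_smul, nsmul_eq_mul]
    exact le_mul_of_one_le_right (Int.natCast_nonneg _) (hh _ (List.get_mem _ _))
  rw [comb, dotProduct_sum]
  exact (hpos i).trans (Finset.single_le_sum (f := fun j => h ⬝ᵥ (c j • V.get j))
    (fun j _ => (Int.natCast_nonneg _).trans (hpos j)) (Finset.mem_univ i))

theorem finite_dotProduct_le {A : Finset (Fin d → ℤ)} {h : Fin d → ℤ} (hh : ∀ a ∈ A, 1 ≤ h ⬝ᵥ a)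
    (N : ℤ) : {v | v ∈ semigroup A ∧ h ⬝ᵥ v ≤ N}.Finite := by
  have hA : A.toList.toFinset = A := Finset.toList_toFinset A
  refine ((Set.finite_Iic fun _ : Fin A.toList.length => N.toNat).image (comb A.toList)).subset ?_
  rintro v ⟨hv, hvN⟩
  rw [← hA, mem_semigroup_toFinset_iff] at hv
  obtain ⟨c, rfl⟩ := hv
  refine ⟨c, fun i => ?_, rfl⟩
  have := coeff_le_dotProduct_comb (fun a ha => hh a (Finset.mem_toList.1 ha)) c i
  change c i ≤ N.toNat
  omega

end Combinations

/-! ### Proper pairs lie below standard pairs. -/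

section StandardPairs

variable {k : Type*} [Field k] {d : ℕ} {A : Finset (Fin d → ℤ)} {I : Ideal (SemigroupRing k A)}

theorem self_mem_pairSet (p : (Fin d → ℤ) × Finset (Fin d → ℤ)) : p.1 ∈ pairSet p :=
  ⟨0, zero_mem _, (add_zero _).symm⟩

theorem semigroup_mono {F G : Finset (Fin d → ℤ)} (h : F ⊆ G) : semigroup F ≤ semigroup G :=
  AddSubmonoid.closure_mono (Finset.coe_subset.2 h)

/-- For `p.1 = q.1 + g` and `f ∈ p.2`, the sum `f + g` lies in the semigroup of the face `q.2`, and
a face contains the summands of its elements. -/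
theorem subset_of_pairSet_subset {p q : (Fin d → ℤ) × Finset (Fin d → ℤ)} (hp : p.2 ⊆ A)
    (hq : IsFace A q.2) (h : pairSet p ⊆ pairSet q) : p.2 ⊆ q.2 := by
  intro f hf
  obtain ⟨g, hg, hg'⟩ := h (self_mem_pairSet p)
  obtain ⟨e, he, he'⟩ := h ⟨f, AddSubmonoid.subset_closure hf, rfl⟩
  have hfe : e = f + g := by
    rw [hg', add_assoc] at he'
    rw [← add_left_cancel he', add_comm]
  refine hq.mem_of_mem_cone f (hp hf) (hq.cone_isFaceOf.mem_of_smul_add_mem (a := 1)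
    (y := castVec g) (castVec_mem_cone (hp hf))
    (cone_mono hq.subset (castVec_mem_cone_of_mem_semigroup hg)) zero_lt_one ?_)
  rw [one_smul]
  have := castVec_mem_cone_of_mem_semigroup he
  rwa [hfe, castVec_add] at this

/-- The base points differ by elements `f`, `g` with `f + g = 0`, and a positive functional forces
`f = 0`. Thus maximality of the sets gives the equality of pairs that `stdPairs` demands. -/
theorem eq_of_pairSet_eq (hA : IsConfiguration A) {p q : (Fin d → ℤ) × Finset (Fin d → ℤ)}
    (hp : IsPair A p) (hq : IsPair A q) (h : pairSet p = pairSet q) : p = q := by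
  obtain ⟨n, hn⟩ := exists_positive_functional hA
  obtain ⟨f, hf, hf'⟩ := h ▸ self_mem_pairSet p
  obtain ⟨g, hg, hg'⟩ := h ▸ self_mem_pairSet q
  have hfg : f + g = 0 := by
    rw [hf', add_assoc] at hg'
    exact left_eq_add.1 hg'
  have hf0 : f = 0 := by
    have hfA := semigroup_mono hq.2.subset hf
    have hgA := semigroup_mono hp.2.subset hg
    refine eq_zero_of_dotProduct_nonpos hn hfA ?_
    have h1 := dotProduct_nonneg hn hgA
    have h2 : n ⬝ᵥ (f + g) = 0 := by rw [hfg, dotProduct_zero]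
    rw [dotProduct_add] at h2
    linarith
  obtain ⟨a, F⟩ := p
  obtain ⟨b, G⟩ := q
  simp only [hf0, add_zero] at hf'
  subst hf'
  have h1 : F ⊆ G := subset_of_pairSet_subset hp.2.subset hq.2 h.le
  have h2 : G ⊆ F := subset_of_pairSet_subset hq.2.subset hp.2 h.ge
  rw [h1.antisymm h2]

/-- Every proper pair is below a standard pair. -/
theorem IsProperPair.exists_stdPair (hA : IsConfiguration A)
    {p : (Fin d → ℤ) × Finset (Fin d → ℤ)} (hp : IsProperPair I p) :
    ∃ q ∈ stdPairs I, pairSet p ⊆ pairSet q := by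
  obtain ⟨n, hn⟩ := exists_positive_functional hA
  let s := {q | IsProperPair I q ∧ pairSet p ⊆ pairSet q}
  -- A pair above `p` has a base point of height at most that of `p.1` and a face inside `A`, so
  -- there are finitely many.
  have hs : s.Finite := by
    refine ((finite_dotProduct_le hn (n ⬝ᵥ p.1)).prod A.powerset.finite_toSet).subset ?_
    rintro q ⟨hq, hpq⟩
    refine ⟨⟨hq.1.1, ?_⟩, Finset.mem_coe.2 (Finset.mem_powerset.2 hq.1.2.subset)⟩
    obtain ⟨c, hc, hc'⟩ := hpq (self_mem_pairSet p)
    rw [hc', dotProduct_add]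
    linarith [dotProduct_nonneg hn (semigroup_mono hq.1.2.subset hc)]
  obtain ⟨q, ⟨hq, hpq⟩, hmax⟩ := hs.exists_maximalFor pairSet s ⟨p, hp, subset_rfl⟩
  refine ⟨q, ⟨hq, fun r hr hqr => ?_⟩, hpq⟩
  exact (eq_of_pairSet_eq hA hq.1 hr.1 (hqr.antisymm (hmax ⟨hr, hpq.trans hqr⟩ hqr))).symm

/-- If the standard monomials of `I` contain `a + ℕS`, then some standard pair of `I` contains
`a + ℕS`. -/
theorem exists_stdPair_of_add_semigroup (hA : IsConfiguration A) {a : Fin d → ℤ}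
    {S : Finset (Fin d → ℤ)} (ha : a ∈ semigroup A) (hS : S ⊆ A)
    (h : ∀ s ∈ semigroup S, a + s ∈ stdMono I) : ∃ q ∈ stdPairs I, a ∈ pairSet q ∧ S ⊆ q.2 := by
  obtain ⟨F, hF, hSF, hdiv⟩ := exists_face hS
  have hproper : IsProperPair I (a, F) := by
    refine ⟨⟨ha, hF⟩, ?_⟩
    rintro x ⟨f, hf, rfl⟩
    obtain ⟨g, hg, hfg⟩ := hdiv f hf
    refine mem_stdMono_of_add_mem (add_mem ha (semigroup_mono hF.subset hf)) hg ?_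
    rw [add_assoc]
    exact h _ hfg
  obtain ⟨q, hq, hpq⟩ := hproper.exists_stdPair hA
  refine ⟨q, hq, hpq (self_mem_pairSet _), ?_⟩
  exact hSF.trans (subset_of_pairSet_subset hF.subset hq.1.1.2 hpq)

end StandardPairs

/-! ### Dickson's lemma and enumeration of boxes. -/

section Boxes

/-- Dickson's lemma: an upward closed set of exponent vectors is determined by its members in a
large enough box. -/
theorem exists_min_mem {n : ℕ} {J : Set (Fin n → ℕ)} (hJ : IsUpperSet J) :
    ∃ M : ℕ, ∀ y ∈ J, (fun i => min (y i) M) ∈ J := by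
  have hfin : {x | Minimal (· ∈ J) x}.Finite :=
    WellQuasiOrderedLE.finite_of_isAntichain (setOfPred_minimal_antichain _)
  obtain ⟨b, hb⟩ := hfin.bddAbove
  -- This sum bounds every coordinate of every minimal element, so truncation keeps `y` above the
  -- minimal element below it.
  refine ⟨∑ i, b i, fun y hy => ?_⟩
  obtain ⟨x, hxy, hx⟩ := (Set.isPWO_of_wellQuasiOrderedLE J).exists_le_minimal hy
  exact hJ (fun i => le_min (hxy i) ((hb hx i).trans
    (Finset.single_le_sum (f := b) (fun _ _ => Nat.zero_le _) (Finset.mem_univ i)))) hx.prop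

theorem exists_digit {b n : ℕ} {c : Fin n → ℕ} (hc : ∀ i, c i < b) :
    ∃ m < b ^ n, ∀ i : Fin n, digit b m i = c i := by
  refine ⟨finFunctionFinEquiv fun i => ⟨c i, hc i⟩, Fin.is_lt _, fun i => ?_⟩
  -- The inverse of `finFunctionFinEquiv` is by definition the base `b` expansion computed by
  -- `digit`.
  have h := finFunctionFinEquiv.symm_apply_apply fun i => (⟨c i, hc i⟩ : Fin b)
  exact congrArg Fin.val (congrFun h i)

theorem digit_lt {b : ℕ} (hb : 0 < b) (m i : ℕ) : digit b m i < b := Nat.mod_lt _ hb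

end Boxes

/-! ### The list codes compute the intended objects. -/

section Coding

variable {d : ℕ}

theorem getD_ofFn (v : Fin d → ℤ) (j : Fin d) : (List.ofFn v).getD j 0 = v j := by
  simp

theorem getD_codePoints (V : List (Fin d → ℤ)) (i : Fin V.length) :
    (codePoints V).getD i [] = List.ofFn (V.get i) := by
  simp [codePoints]

theorem length_codePoints (V : List (Fin d → ℤ)) : (codePoints V).length = V.length := by
  simp [codePoints]

theorem mem_codePoints {V : List (Fin d → ℤ)} {v : Fin d → ℤ} :
    List.ofFn v ∈ codePoints V ↔ v ∈ V := by
  simp [codePoints, List.mem_map, List.ofFn_inj]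

theorem sum_map_range {M : Type*} [AddCommMonoid M] (n : ℕ) (f : ℕ → M) :
    ((List.range n).map f).sum = ∑ i : Fin n, f i := by
  rw [← Finset.sum_range]
  rfl

theorem digitComb_codePoints (V : List (Fin d → ℤ)) (b m : ℕ) (j : Fin d) :
    digitComb (codePoints V) b m j = comb V (fun i => digit b m i) j := by
  rw [digitComb, length_codePoints, sum_map_range, comb, Finset.sum_apply]
  refine Finset.sum_congr rfl fun i _ => ?_
  rw [getD_codePoints, getD_ofFn, Pi.smul_apply, nsmul_eq_mul]

theorem digitPoint_codePoints (V : List (Fin d → ℤ)) (b m : ℕ) :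
    digitPoint d (codePoints V) b m = List.ofFn (comb V fun i => digit b m i) := by
  rw [digitPoint, List.ofFn_eq_map, ← List.map_coe_finRange_eq_range, List.map_map]
  exact List.map_congr_left fun j _ => digitComb_codePoints V b m j

/-- The length of `h` is irrelevant: missing entries count as `0` and surplus ones are never read.
-/
theorem height_ofFn (h : List ℤ) (v : Fin d → ℤ) :
    height h (List.ofFn v) = (fun j : Fin d => h.getD j 0) ⬝ᵥ v := by
  rw [height, List.length_ofFn, sum_map_range]
  exact Finset.sum_congr rfl fun j _ => by rw [getD_ofFn]

theorem memCode_iff {A : Finset (Fin d → ℤ)} {h : List ℤ}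
    (hh : ∀ a ∈ A, 1 ≤ (fun j : Fin d => h.getD j 0) ⬝ᵥ a) {a v : Fin d → ℤ}
    {F : List (Fin d → ℤ)} (ha : a ∈ semigroup A) (hF : F.toFinset ⊆ A) :
    MemCode d h (List.ofFn a, codePoints F) (List.ofFn v) ↔ v ∈ pairSet (a, F.toFinset) := by
  have key : ∀ b m, (∀ j < d, (List.ofFn v).getD j 0 =
      (List.ofFn a).getD j 0 + digitComb (codePoints F) b m j) ↔
      v = a + comb F fun i => digit b m i := fun b m => by
    rw [funext_iff, Fin.forall_iff]
    refine forall₂_congr fun j hj => ?_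
    have h1 := getD_ofFn v ⟨j, hj⟩
    have h2 := getD_ofFn a ⟨j, hj⟩
    have h3 := digitComb_codePoints F b m ⟨j, hj⟩
    dsimp only at h1 h2 h3
    rw [h1, h2, h3, Pi.add_apply]
  simp only [MemCode, key, length_codePoints]
  constructor
  · rintro ⟨m, -, hm⟩
    exact ⟨_, comb_mem _, hm⟩
  · rintro ⟨f, hf, rfl⟩
    obtain ⟨c, rfl⟩ := mem_semigroup_toFinset_iff.1 hf
    obtain ⟨m, hm, hmc⟩ := exists_digit (c := c)
      -- Since `a` has nonnegative height, each coefficient is at most the height of `a + comb F c`,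
      -- hence a digit in this base.
      (b := (height h (List.ofFn (a + comb F c))).toNat + 1) fun i => by
        have h1 := coeff_le_dotProduct_comb (fun x hx => hh x (hF (List.mem_toFinset.2 hx))) c i
        have h2 := dotProduct_nonneg hh ha
        rw [height_ofFn, dotProduct_add]
        omega
    exact ⟨m, hm, by simp only [hmc]⟩

end Coding

/-! ### Certificates exist, and each one suffices. -/

section Correctness

variable {k : Type*} [Field k] {d : ℕ} {A : Finset (Fin d → ℤ)} {I : Ideal (SemigroupRing k A)}
  {L : List (Fin d → ℤ)} {P : List ((Fin d → ℤ) × List (Fin d → ℤ))}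

/-- Taking `S = ∅` shows that the standard pairs cover all standard monomials. -/
theorem mem_stdMono_iff_exists_pair (hA : IsConfiguration A)
    (hP : {q | ∃ p ∈ P, (p.1, p.2.toFinset) = q} = stdPairs I) {v : Fin d → ℤ} :
    v ∈ stdMono I ↔ ∃ p ∈ P, v ∈ pairSet (p.1, p.2.toFinset) := by
  constructor
  · intro hv
    obtain ⟨q, hq, hvq, -⟩ := exists_stdPair_of_add_semigroup (S := ∅) hA hv.1
      (Finset.empty_subset A) (fun s hs => by
        rw [semigroup, Finset.coe_empty, AddSubmonoid.closure_empty, AddSubmonoid.mem_bot] at hs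
        rwa [hs, add_zero])
    rw [← hP] at hq
    obtain ⟨p, hp, rfl⟩ := hq
    exact ⟨p, hp, hvq⟩
  · rintro ⟨p, hp, hv⟩
    have hq : (p.1, p.2.toFinset) ∈ stdPairs I := hP ▸ ⟨p, hp, rfl⟩
    exact hq.1.2 hv

theorem memCode_iff_of_stdPairs (hP : {q | ∃ p ∈ P, (p.1, p.2.toFinset) = q} = stdPairs I)
    {h : List ℤ} (hh : ∀ a ∈ A, 1 ≤ (fun j : Fin d => h.getD j 0) ⬝ᵥ a)
    {p : (Fin d → ℤ) × List (Fin d → ℤ)} (hp : p ∈ P) {b m : ℕ} :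
    MemCode d h (List.ofFn p.1, codePoints p.2) (digitPoint d (codePoints L) b m) ↔
      (comb L fun i => digit b m i) ∈ pairSet (p.1, p.2.toFinset) := by
  have hq : (p.1, p.2.toFinset) ∈ stdPairs I := hP ▸ ⟨p, hp, rfl⟩
  rw [digitPoint_codePoints, memCode_iff hh hq.1.1.1 hq.1.1.2.subset]

theorem isGenCode_iff (hA : IsConfiguration A)
    (hP : {q | ∃ p ∈ P, (p.1, p.2.toFinset) = q} = stdPairs I) {c : ℕ × List ℤ}
    (hh : ∀ a ∈ A, 1 ≤ (fun j : Fin d => c.2.getD j 0) ⬝ᵥ a) {m : ℕ} :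
    IsGenCode (d, codePoints L, codePairs P) c m ↔
      (comb L fun i => digit (c.1 + 1) m i) ∉ stdMono I := by
  rw [mem_stdMono_iff_exists_pair hA hP, IsGenCode]
  simp only [codePairs, List.forall_mem_map]
  push Not
  exact forall₂_congr fun p hp => not_congr (memCode_iff_of_stdPairs hP hh hp)

theorem isStdCode_iff (hP : {q | ∃ p ∈ P, (p.1, p.2.toFinset) = q} = stdPairs I) {c : ℕ × List ℤ}
    (hh : ∀ a ∈ A, 1 ≤ (fun j : Fin d => c.2.getD j 0) ⬝ᵥ a) {m : ℕ} :
    IsStdCode (d, codePoints L, codePairs P) c m ↔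
      ∃ p ∈ P, (comb L fun i => digit (c.1 + 1) m i) ∈ pairSet (p.1, p.2.toFinset) ∧
        ∀ i : Fin L.length, digit (c.1 + 1) m i = c.1 → L.get i ∈ p.2 := by
  simp only [IsStdCode, codePairs, List.mem_map, exists_exists_and_eq_and,
    length_codePoints]
  refine exists_congr fun p => and_congr_right fun hp =>
    and_congr (memCode_iff_of_stdPairs hP hh hp) ?_
  rw [Fin.forall_iff]
  refine forall₂_congr fun i hi => imp_congr Iff.rfl ?_
  rw [← mem_codePoints, ← getD_codePoints]

/-- Positivity of the functional is settled first, since the coded membership tests are justified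
only under it. -/
theorem certifies_iff (hA : IsConfiguration A) (hL : L.toFinset = A)
    (hP : {q | ∃ p ∈ P, (p.1, p.2.toFinset) = q} = stdPairs I) {c : ℕ × List ℤ} :
    Certifies (d, codePoints L, codePairs P) c ↔
      (∀ a ∈ A, 1 ≤ (fun j : Fin d => c.2.getD j 0) ⬝ᵥ a) ∧
      ∀ x : Fin L.length → ℕ, (∀ i, x i ≤ c.1) → comb L x ∈ stdMono I →
        ∃ p ∈ P, comb L x ∈ pairSet (p.1, p.2.toFinset) ∧ ∀ i, x i = c.1 → L.get i ∈ p.2 := by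
  have h1 : (∀ l ∈ codePoints L, 1 ≤ height c.2 l) ↔
      ∀ a ∈ A, 1 ≤ (fun j : Fin d => c.2.getD j 0) ⬝ᵥ a := by
    simp [codePoints, height_ofFn, ← hL]
  rw [Certifies, h1]
  refine and_congr_right fun hh => ?_
  simp only [length_codePoints, isGenCode_iff hA hP hh, isStdCode_iff hP hh]
  constructor
  · intro H x hx hstd
    obtain ⟨m, hm, hmx⟩ := exists_digit (c := x) (b := c.1 + 1) fun i => Nat.lt_succ_of_le (hx i)
    have := H m hm
    simp only [hmx] at this
    exact this.resolve_right (not_not_intro hstd)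
  · intro H m _
    by_cases hstd : (comb L fun i => digit (c.1 + 1) m i) ∈ stdMono I
    · exact Or.inl (H _ (fun i => Nat.le_of_lt_succ (digit_lt c.1.succ_pos m i)) hstd)
    · exact Or.inr hstd

theorem exists_certifies (hA : IsConfiguration A) (hL : L.toFinset = A)
    (hP : {q | ∃ p ∈ P, (p.1, p.2.toFinset) = q} = stdPairs I) :
    ∃ c, Certifies (d, codePoints L, codePairs P) c := by
  obtain ⟨h, hh⟩ := exists_positive_functional hA
  have hLA : ∀ x, comb L x ∈ semigroup A := fun x => hL ▸ comb_mem x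
  have hup : IsUpperSet {x : Fin L.length → ℕ | comb L x ∉ stdMono I} := by
    intro x y hxy hx hy
    obtain ⟨z, rfl⟩ := exists_add_of_le hxy
    rw [comb_add] at hy
    exact hx (mem_stdMono_of_add_mem (hLA x) (hLA z) hy)
  obtain ⟨M, hM⟩ := exists_min_mem hup
  refine ⟨(M, List.ofFn h), (certifies_iff hA hL hP).2 ⟨fun a ha => ?_, fun x hx hstd => ?_⟩⟩
  · simp only [getD_ofFn]
    exact hh a ha
  · classical
    let S := (Finset.univ.filter fun i => x i = M).image L.get
    have hS : S ⊆ A := fun s hs => by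
      obtain ⟨i, -, rfl⟩ := Finset.mem_image.1 hs
      exact hL ▸ List.mem_toFinset.2 (List.get_mem _ _)
    obtain ⟨q, hq, hxq, hSq⟩ := exists_stdPair_of_add_semigroup (I := I) hA (hLA x) hS (by
      intro s hs
      -- Lift `s` to an exponent vector supported where `x` equals `M`, so that `x + z` truncates
      -- back to `x`.
      obtain ⟨z, hz, rfl⟩ : ∃ z : Fin L.length → ℕ, (∀ i, z i ≠ 0 → x i = M) ∧ s = comb L z := by
        induction hs using AddSubmonoid.closure_induction with
        | mem s hs =>
          obtain ⟨i, hi, rfl⟩ := Finset.mem_image.1 hs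
          refine ⟨Pi.single i 1, fun j hj => ?_, ?_⟩
          · have : j = i := by
              by_contra hne
              exact hj (Pi.single_eq_of_ne hne 1)
            exact this ▸ (Finset.mem_filter.1 hi).2
          · rw [comb, Finset.sum_eq_single i (fun j _ hj => by simp [hj]) (by simp)]
            simp
        | zero => exact ⟨0, fun i hi => absurd rfl hi, by simp [comb]⟩
        | add s t _ _ hs ht =>
          obtain ⟨z, hz, rfl⟩ := hs
          obtain ⟨w, hw, rfl⟩ := ht
          refine ⟨z + w, fun i hi => ?_, (comb_add _ _ _).symm⟩
          by_cases h0 : z i = 0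
          · exact hw i fun h1 => hi (by simp [h0, h1])
          · exact hz i h0
      rw [← comb_add]
      by_contra hc
      have hmin : (fun i => min ((x + z) i) M) = x := funext fun i => by
        have := hx i
        have := hz i
        simp only [Pi.add_apply] at *
        omega
      exact (hmin ▸ hM _ hc : x ∈ {x | comb L x ∉ stdMono I}) hstd)
    rw [← hP] at hq
    obtain ⟨p, hp, rfl⟩ := hq
    exact ⟨p, hp, hxq, fun i hi => List.mem_toFinset.1 (hSq (Finset.mem_image_of_mem _
      (Finset.mem_filter.2 ⟨Finset.mem_univ i, hi⟩)))⟩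

/-- A certificate guarantees that the output generates the ideal. -/
theorem span_output_eq (hA : IsConfiguration A) (hI : IsMonomialIdeal I) (hL : L.toFinset = A)
    (hP : {q | ∃ p ∈ P, (p.1, p.2.toFinset) = q} = stdPairs I) {c : ℕ × List ℤ}
    (hc : Certifies (d, codePoints L, codePairs P) c) :
    ∃ gens : List (semigroup A),
      codePoints (gens.map Subtype.val) = output (d, codePoints L, codePairs P) c ∧
      Ideal.span (monomial k A '' {g | g ∈ gens}) = I := by
  classical
  obtain ⟨hh, hbox⟩ := (certifies_iff hA hL hP).1 hc
  have hLA : ∀ x, comb L x ∈ semigroup A := fun x => hL ▸ comb_mem x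
  let pt : ℕ → semigroup A := fun m => ⟨comb L fun i => digit (c.1 + 1) m i, hLA _⟩
  refine ⟨((List.range ((c.1 + 1) ^ L.length)).filter fun m =>
    IsGenCode (d, codePoints L, codePairs P) c m).map pt, ?_, le_antisymm ?_ ?_⟩
  · rw [output, List.map_map, codePoints, List.map_map, length_codePoints]
    exact List.map_congr_left fun m _ => (digitPoint_codePoints L (c.1 + 1) m).symm
  · rw [Ideal.span_le]
    rintro _ ⟨g, hg, rfl⟩
    obtain ⟨m, hm, rfl⟩ := List.mem_map.1 hg
    have hgen := (isGenCode_iff hA hP hh).1 (of_decide_eq_true (List.mem_filter.1 hm).2)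
    by_contra hI'
    exact hgen ((mem_stdMono_iff (pt m)).2 hI')
  · refine hI.le_of_monomial_mem fun a ha => ?_
    obtain ⟨y, hy⟩ := mem_semigroup_toFinset_iff.1 (hL.symm ▸ a.2 : a.1 ∈ semigroup L.toFinset)
    let x : Fin L.length → ℕ := fun i => min (y i) c.1
    have hxy : y = x + fun i => y i - x i := funext fun i => by simp [x]
    have hx : comb L x ∉ stdMono I := by
      intro hstd
      obtain ⟨p, hp, ⟨f, hf, hxf⟩, hF⟩ := hbox x (fun i => min_le_right _ _) hstd
      -- A coordinate lost in the truncation satisfies `x i = c.1`, so the certificate puts its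
      -- generator in the face.
      have hrest : comb L (fun i => y i - x i) ∈ semigroup p.2.toFinset :=
        comb_mem_of_support fun i hi => List.mem_toFinset.2 (hF i (by simp [x] at hi ⊢; omega))
      have : a.1 ∈ stdMono I := (mem_stdMono_iff_exists_pair hA hP).2
        ⟨p, hp, f + comb L (fun i => y i - x i), add_mem hf hrest, by
          rw [hy, hxy, comb_add, hxf, add_assoc, ← hxy]⟩
      exact (mem_stdMono_iff a).1 this ha
    obtain ⟨m, hm, hmx⟩ := exists_digit (c := x) (b := c.1 + 1)
      fun i => Nat.lt_succ_of_le (min_le_right _ _)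
    have hpt : (pt m).1 = comb L x := by simp only [pt, hmx]
    have ha' : a = pt m + ⟨comb L fun i => y i - x i, hLA _⟩ := Subtype.ext (by
      rw [AddSubmonoid.coe_add, hpt, ← comb_add, ← hxy, hy])
    rw [ha']
    refine monomial_add_mem _ (Ideal.subset_span ⟨pt m, List.mem_map.2 ⟨m, List.mem_filter.2
      ⟨List.mem_range.2 hm, decide_eq_true ((isGenCode_iff hA hP hh).2 ?_)⟩, rfl⟩, rfl⟩)
    simpa only [hmx] using hx

end Correctness

end StdPairs

/-- One partial recursive function `f`, independent of the dimension, the configuration, the field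
and the ideal, halts on every input `(d, A, stdPairs I)`, where the sets `A`, `stdPairs I` and the
faces in it are given by arbitrary lists of their elements, and returns a list of the exponents of
finitely many monomials that generate `I`. -/
theorem mainTheorem10 :
    ∃ f : ℕ × List (List ℤ) × List (List ℤ × List (List ℤ)) →. List (List ℤ),
      Partrec f ∧
      ∀ (d : ℕ) (A : Finset (Fin d → ℤ)), StdPairs.IsConfiguration A →
      ∀ (k : Type*) [Field k] (I : Ideal (StdPairs.SemigroupRing k A)),
        StdPairs.IsMonomialIdeal I →
      ∀ (L : List (Fin d → ℤ)) (P : List ((Fin d → ℤ) × List (Fin d → ℤ))),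
        L.toFinset = A →
        {q | ∃ p ∈ P, (p.1, p.2.toFinset) = q} = StdPairs.stdPairs I →
        ∃ gens : List (StdPairs.semigroup A),
          StdPairs.codePoints (gens.map Subtype.val) ∈
            f (d, StdPairs.codePoints L, StdPairs.codePairs P) ∧
          Ideal.span (StdPairs.monomial k A '' {g | g ∈ gens}) = I := by
  refine ⟨StdPairs.algorithm, StdPairs.partrec_algorithm, ?_⟩
  intro d A hA k _ I hI L P hL hP
  obtain ⟨c, hc⟩ := StdPairs.exists_certifies hA hL hP
  obtain ⟨y, hy⟩ := Part.dom_iff_mem.1 (StdPairs.algorithm_dom hc)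
  -- The search may stop at a certificate other than `c`; correctness holds for any of them.
  obtain ⟨c', hc', rfl⟩ := StdPairs.exists_certifies_of_mem_algorithm hy
  obtain ⟨gens, hgens, hspan⟩ := StdPairs.span_output_eq hA hI hL hP hc'
  exact ⟨gens, hgens.symm ▸ hy, hspan⟩
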